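/- Let $n\ge 3$, let $\mathbb{R}^{n+1,1}$ be Lorentzian space with inner product $(\cdot,\cdot)$ and light-cone $\mathcal{L}$, and identify $S^n\cong\mathbb{P}(\mathcal{L})$ (as conformal manifolds); its $k$-dimensional subspheres are the sets $\mathbb{P}(\mathcal{L}\cap W)$ with $W\subset\mathbb{R}^{n+1,1}$ a linear subspace of signature $(k+1,1)$, and such a subsphere is proper if $k<n$. Identify $\wedge^2\mathbb{R}^{n+1,1}$ with the orthogonal algebra $o(\mathbb{R}^{n+1,1})$ by $(u\wedge v)(w)=(u,w)v-(v,w)u$. Let $\Sigma$ be a connected oriented smooth surface and $\Lambda:\Sigma\to\mathbb{P}(\mathcal{L})$ a smooth immersion, viewed as a null line subbundle of $\Sigma\times\mathbb{R}^{n+1,1}$. Let $\sigma$ be a never-zero section (lift) of $\Lambda$ and $g_\sigma(X,Y)=(\mathrm{d}\sigma(X),\mathrm{d}\sigma(Y))$; give $\Sigma$ the complex structure $J$ determined by the conformal class of $g_\sigma$ and the orientation, which defines the $(1,0)$- and $(0,1)$-parts of $1$-forms and the Hodge star $*\alpha=-\alpha\circ J$ on $1$-forms. Put $\Lambda^{(1)}=\Lambda\oplus\mathrm{d}\sigma(T\Sigma)$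 and let $S=\Lambda^{(1)}\oplus\langle\Delta\sigma\rangle$ be the central sphere congruence of $\Lambda$, where $\Delta$ is the Laplacian of $g_\sigma$ (these are independent of the lift $\sigma$). Write $\mathrm{d}=\mathcal{D}+\mathcal{N}$ for the trivial flat connection $\mathrm{d}$ on $\Sigma\times\mathbb{R}^{n+1,1}=S\oplus S^\perp$, where $\mathcal{D}$ is the sum of the connections induced by $\mathrm{d}$ on $S$ and $S^\perp$. Bundles, connections and forms are extended to complexifications when needed. For a real $1$-form $q\in\Omega^1(\Lambda\wedge\Lambda^{(1)})$, the pair $(\Lambda,q)$ is a constrained Willmore surface if $\mathrm{d}^{\mathcal{D}}q=0$ and $\mathrm{d}^{\mathcal{D}}{*\mathcal{N}}=2[q\wedge *\mathcal{N}]$. For $\lambda\in\mathbb{C}\setminus\{0\}$ put $$\mathrm{d}^\lambda_q=\mathcal{D}+\lambda\mathcal{N}^{1,0}+\lambda^{-1}\mathcal{N}^{0,1}+(\lambda^2-1)q^{1,0}+(\lambda^{-2}-1)q^{0,1}.$$ A constrained Willmore surface $(\Lambda,q)$ is special of type $d\in\mathbb{N}_0$ if there is a Laurent polynomial $p(\lambda)=\sum_{k=-d}^{d}p_k\lambda^k$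 whose coefficients are smooth sections of $\Sigma\times\mathbb{C}^{n+2}$, with $p_{-k}=\overline{p_k}$ for all $k$, with $p_k\in\Gamma(S^\perp)$ if $k$ and $d$ have the same parity (in particular $p_d\in\Gamma(S^\perp)$) and $p_k\in\Gamma(S)$ otherwise, with $p(1)\ne 0$, and with $\mathrm{d}^\lambda_q\,p(\lambda)=0$ for all $\lambda\in\mathbb{C}\setminus\{0\}$. **Proposition.** Let $(\Lambda,q)$ be a constrained Willmore surface. Then $(\Lambda,q)$ is a special constrained Willmore surface of type $0$ if and only if $\Lambda$ is not full, that is, $\Lambda(\Sigma)$ is contained in some proper subsphere of $S^n$. -/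

import Mathlib

open scoped Manifold ContDiff LinearAlgebra.Projectivization

noncomputable section

namespace CW

/-! ### The Lorentzian space and the conformal sphere -/

/-- The vector space underlying `ℝ^{n+1,1}`. -/
abbrev V (n : ℕ) : Type := Fin (n + 2) → ℝ

/-- The complexification of `ℝ^{n+1,1}`. -/
abbrev VC (n : ℕ) : Type := Fin (n + 2) → ℂ

/-- The Lorentzian inner product, `x₀ y₀ + … + xₙ yₙ - xₙ₊₁ yₙ₊₁`. -/
def lor (n : ℕ) : LinearMap.BilinForm ℝ (V n) :=
  Matrix.toBilin' (Matrix.diagonal fun i => if i = Fin.last (n + 1) then -1 else 1)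

/-- The identification of `∧² ℝ^{n+1,1}` with the orthogonal algebra:
`(u ∧ v)(w) = (u, w) v - (v, w) u`. -/
def wedge {n : ℕ} (u v : V n) : V n →ₗ[ℝ] V n :=
  (lor n u).smulRight v - (lor n v).smulRight u

/-- The conformal `n`-sphere: the projectivised light-cone `ℙ(𝓛)`. -/
def ConformalSphere (n : ℕ) : Type :=
  {ℓ : ℙ ℝ (V n) // ∀ v ∈ ℓ.submodule, lor n v v = 0}

/-- The (null) line in `ℝ^{n+1,1}` given by a point of the conformal sphere. -/
def ConformalSphere.line {n : ℕ} (ℓ : ConformalSphere n) : Submodule ℝ (V n) := ℓ.1.submodule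

/-- A `k`-dimensional subsphere of the conformal sphere: `ℙ(𝓛 ∩ W)` for a subspace `W` of
signature `(k+1, 1)`, that is, a `(k+2)`-dimensional subspace with a time-like vector. -/
def IsSubsphere {n : ℕ} (k : ℕ) (s : Set (ConformalSphere n)) : Prop :=
  ∃ W : Submodule ℝ (V n), Module.finrank ℝ W = k + 2 ∧ (∃ w ∈ W, lor n w w < 0) ∧
    s = {ℓ | ℓ.line ≤ W}

/-! ### Surfaces -/

/-- The model plane. -/
abbrev E2 : Type := EuclideanSpace ℝ (Fin 2)

/-- The atlas is oriented: all transition maps have positive Jacobian determinant. Every tangent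
space, which Mathlib identifies with the model plane by the preferred chart at the point, is then
oriented by the standard orientation of the plane. -/
class OrientedAtlas (M : Type*) [TopologicalSpace M] [ChartedSpace E2 M] : Prop where
  det_pos : ∀ φ ∈ atlas E2 M, ∀ ψ ∈ atlas E2 M, ∀ x ∈ φ.source ∩ ψ.source,
    0 < (fderiv ℝ (ψ ∘ φ.symm) (φ x)).det

section Surface

variable {M : Type*} [TopologicalSpace M] [ChartedSpace E2 M] {n : ℕ}

/-- The derivative of a `ℝ^{n+1,1}`-valued function at a tangent vector: the trivial flat
connection. -/
def dd (φ : M → V n) (x : M) (X : TangentSpace (𝓡 2) x) : V n :=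
  mfderiv (𝓡 2) 𝓘(ℝ, V n) φ x X

/-- The metric `g_σ(X, Y) = (dσ X, dσ Y)`. -/
def metric (σ : M → V n) (x : M) (X Y : TangentSpace (𝓡 2) x) : ℝ :=
  lor n (dd σ x X) (dd σ x Y)

/-- The `i`-th coordinate vector. -/
def e (i : Fin 2) : E2 := EuclideanSpace.single i 1

/-- The complex structure of the tangent plane at `x` that is given by `g_σ` and the orientation:
rotation by a positive right angle. With `A, F, G` the coefficients of `g_σ` in the positive basis
`e₀, e₁` it is `J e₀ = (-F e₀ + A e₁) / √(A G - F²)`, `J e₁ = (-G e₀ + F e₁) / √(A G - F²)`. -/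
def rot (σ : M → V n) (x : M) (X : TangentSpace (𝓡 2) x) : TangentSpace (𝓡 2) x :=
  let A : ℝ := metric σ x (e 0) (e 0)
  let F : ℝ := metric σ x (e 0) (e 1)
  let G : ℝ := metric σ x (e 1) (e 1)
  let Z : E2 := X
  ((√(A * G - F ^ 2))⁻¹ • ((-(F * Z 0 + G * Z 1)) • e 0 + (A * Z 0 + F * Z 1) • e 1) : E2)

/-- Partial derivative in the plane. -/
def pd (i : Fin 2) (f : E2 → V n) (y : E2) : V n := fderiv ℝ f y (e i)

/-- The first fundamental form `(∂ᵢ f, ∂ⱼ f)` of a map of (an open subset of) the plane. -/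
def gram (f : E2 → V n) (y : E2) : Matrix (Fin 2) (Fin 2) ℝ :=
  Matrix.of fun i j => lor n (pd i f y) (pd j f y)

/-- The Laplacian of `σ` with respect to `g_σ`, computed in the preferred chart at `x`:
`|g|^{-1/2} ∑ᵢ ∂ᵢ (|g|^{1/2} ∑ⱼ g^{ij} ∂ⱼ σ)`. -/
def laplacian (σ : M → V n) (x : M) : V n :=
  let φ := chartAt E2 x
  let f : E2 → V n := σ ∘ φ.symm
  (√(gram f (φ x)).det)⁻¹ •
    ∑ i, pd i (fun y => √(gram f y).det • ∑ j, (gram f y)⁻¹ i j • pd j f y) (φ x)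

/-- The lift of `Λ` with last coordinate `1`, that is, the lift to `S_v` for the unit time-like
vector `v = (0, …, 0, 1)`; it exists for every `Λ` since a non-zero null vector has non-zero last
coordinate, and it identifies `ℙ(𝓛)` with the round `n`-sphere `S_v`. -/
def lift (Λ : M → ConformalSphere n) (x : M) : V n :=
  ((Λ x).1.rep (Fin.last (n + 1)))⁻¹ • (Λ x).1.rep

/-- `Λ` is a smooth immersion of `M` in the conformal sphere. -/
structure IsSurface (Λ : M → ConformalSphere n) : Prop where
  smooth : ContMDiff (𝓡 2) 𝓘(ℝ, V n) ∞ (lift Λ)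
  immersion : ∀ x, Function.Injective (mfderiv (𝓡 2) 𝓘(ℝ, V n) (lift Λ) x)

/-- `Λ` is full: it does not lie in any proper subsphere. -/
def IsFull (Λ : M → ConformalSphere n) : Prop :=
  ∀ k < n, ∀ s : Set (ConformalSphere n), IsSubsphere k s → ¬ Set.range Λ ⊆ s

/-- The complex structure `J` of `M` that is induced by `Λ` and the orientation. -/
def J (Λ : M → ConformalSphere n) (x : M) (X : TangentSpace (𝓡 2) x) : TangentSpace (𝓡 2) x :=
  rot (lift Λ) x X

/-- The bundle `Λ^{(1)} = Λ + dσ(TM)`. -/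
def Lam1 (Λ : M → ConformalSphere n) (x : M) : Submodule ℝ (V n) :=
  (Λ x).line ⊔ Submodule.span ℝ (Set.range (dd (lift Λ) x))

/-- The central sphere congruence `S = Λ^{(1)} ⊕ ⟨Δσ⟩`. -/
def S (Λ : M → ConformalSphere n) (x : M) : Submodule ℝ (V n) :=
  Lam1 Λ x ⊔ Submodule.span ℝ {laplacian (lift Λ) x}

/-- The bundle `S^⊥`. -/
def Sperp (Λ : M → ConformalSphere n) (x : M) : Submodule ℝ (V n) := (lor n).orthogonal (S Λ x)

open Classical in
/-- The orthogonal projection on `S`. (For an immersion `S` is never degenerate, so that the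
second case does not occur.) -/
def piS (Λ : M → ConformalSphere n) (x : M) : V n →ₗ[ℝ] V n :=
  if h : IsCompl (S Λ x) (Sperp Λ x) then Submodule.projection (S Λ x) (Sperp Λ x) h else 0

/-- The orthogonal projection on `S^⊥`. -/
def piP (Λ : M → ConformalSphere n) (x : M) : V n →ₗ[ℝ] V n := LinearMap.id - piS Λ x

/-! ### The connections -/

/-- A `1`-form whose values are operators on sections of the trivial bundle: connections and
endomorphism-valued `1`-forms. -/
abbrev OpForm (M : Type*) [TopologicalSpace M] [ChartedSpace E2 M] (n : ℕ) :=
  (x : M) → TangentSpace (𝓡 2) x → (M → V n) → V n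

/-- The connection `𝓓`, the sum of the connections induced on `S` and `S^⊥`. -/
def D (Λ : M → ConformalSphere n) : OpForm M n := fun x X ξ =>
  piS Λ x (dd (fun y => piS Λ y (ξ y)) x X) + piP Λ x (dd (fun y => piP Λ y (ξ y)) x X)

/-- The form `𝓝 = d - 𝓓`. -/
def N (Λ : M → ConformalSphere n) : OpForm M n := fun x X ξ =>
  piP Λ x (dd (fun y => piS Λ y (ξ y)) x X) + piS Λ x (dd (fun y => piP Λ y (ξ y)) x X)

/-- Real `1`-forms with values in the endomorphisms of `ℝ^{n+1,1}`. -/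
abbrev EndForm (M : Type*) [TopologicalSpace M] [ChartedSpace E2 M] (n : ℕ) :=
  (x : M) → TangentSpace (𝓡 2) x →ₗ[ℝ] V n →ₗ[ℝ] V n

/-- The action of an endomorphism-valued form on sections. -/
def EndForm.op (q : EndForm M n) : OpForm M n := fun x X ξ => q x X (ξ x)

/-- The Hodge star on `1`-forms, `*α = -α ∘ J`. -/
def star (Λ : M → ConformalSphere n) (A : OpForm M n) : OpForm M n :=
  fun x X ξ => - A x (J Λ x X) ξ

/-- Smooth vector fields. -/
def IsSmoothField [IsManifold (𝓡 2) ∞ M] (X : (x : M) → TangentSpace (𝓡 2) x) : Prop :=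
  ContMDiff (𝓡 2) (𝓡 2).tangent ∞ fun x => (⟨x, X x⟩ : TangentBundle (𝓡 2) M)

/-- `(d^𝓓 A)(X, Y) ξ`, where
`(d^𝓓 A)(X, Y) = [𝓓_X, A_Y] - [𝓓_Y, A_X] - A_{[X, Y]}`. -/
def extD (Λ : M → ConformalSphere n) (A : OpForm M n) (X Y : (x : M) → TangentSpace (𝓡 2) x)
    (ξ : M → V n) (x : M) : V n :=
  (D Λ x (X x) (fun y => A y (Y y) ξ) - A x (Y x) (fun y => D Λ y (X y) ξ))
    - (D Λ x (Y x) (fun y => A y (X y) ξ) - A x (X x) (fun y => D Λ y (Y y) ξ))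
    - A x (VectorField.mlieBracket (𝓡 2) X Y x) ξ

/-- `[A ∧ B](X, Y) ξ`, where `[A ∧ B](X, Y) = [A_X, B_Y] - [A_Y, B_X]`. -/
def bracketWedge (A B : OpForm M n) (X Y : (x : M) → TangentSpace (𝓡 2) x)
    (ξ : M → V n) (x : M) : V n :=
  (A x (X x) (fun y => B y (Y y) ξ) - B x (Y x) (fun y => A y (X y) ξ))
    - (A x (Y x) (fun y => B y (X y) ξ) - B x (X x) (fun y => A y (Y y) ξ))

/-- `(Λ, q)` is a constrained Willmore surface: `Λ` is an immersion, and `q` is a real smooth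
`1`-form with values in `Λ ∧ Λ^{(1)}` that satisfies `d^𝓓 q = 0` and
`d^𝓓 *𝓝 = 2 [q ∧ *𝓝]`. -/
structure IsConstrainedWillmore [IsManifold (𝓡 2) ∞ M] (Λ : M → ConformalSphere n)
    (q : EndForm M n) : Prop where
  surface : IsSurface Λ
  q_smooth : ∀ X, IsSmoothField X → ∀ v : V n,
    ContMDiff (𝓡 2) 𝓘(ℝ, V n) ∞ fun x => q x (X x) v
  q_mem : ∀ x X, q x X ∈
    Submodule.span ℝ {T | ∃ u ∈ (Λ x).line, ∃ v ∈ Lam1 Λ x, T = wedge u v}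
  q_closed : ∀ X Y, IsSmoothField X → IsSmoothField Y → ∀ ξ : M → V n,
    ContMDiff (𝓡 2) 𝓘(ℝ, V n) ∞ ξ → ∀ x, extD Λ q.op X Y ξ x = 0
  euler_lagrange : ∀ X Y, IsSmoothField X → IsSmoothField Y → ∀ ξ : M → V n,
    ContMDiff (𝓡 2) 𝓘(ℝ, V n) ∞ ξ → ∀ x,
      extD Λ (star Λ (N Λ)) X Y ξ x = (2 : ℝ) • bracketWedge q.op (star Λ (N Λ)) X Y ξ x

/-! ### Complexification and polynomial conserved quantities -/

/-- The real part of a complex vector. -/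
def re (v : VC n) : V n := fun i => (v i).re

/-- The imaginary part of a complex vector. -/
def im (v : VC n) : V n := fun i => (v i).im

/-- The complex vector `u + i v`. -/
def mkC (u v : V n) : VC n := fun i => ⟨u i, v i⟩

/-- Membership in the complexification of a real subspace. -/
def MemC (W : Submodule ℝ (V n)) (v : VC n) : Prop := re v ∈ W ∧ im v ∈ W

/-- The complex linear extension of an operator form to complex sections. -/
def ext (A : OpForm M n) (x : M) (X : TangentSpace (𝓡 2) x) (ξ : M → VC n) : VC n :=
  mkC (A x X fun y => re (ξ y)) (A x X fun y => im (ξ y))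

/-- The `(1,0)`-part `½ (A_X - i A_{JX})` of a form. -/
def part10 (Λ : M → ConformalSphere n) (A : OpForm M n) (x : M) (X : TangentSpace (𝓡 2) x)
    (ξ : M → VC n) : VC n :=
  (1 / 2 : ℂ) • (ext A x X ξ - Complex.I • ext A x (J Λ x X) ξ)

/-- The `(0,1)`-part `½ (A_X + i A_{JX})` of a form. -/
def part01 (Λ : M → ConformalSphere n) (A : OpForm M n) (x : M) (X : TangentSpace (𝓡 2) x)
    (ξ : M → VC n) : VC n :=
  (1 / 2 : ℂ) • (ext A x X ξ + Complex.I • ext A x (J Λ x X) ξ)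

/-- The connection
`d^λ_q = 𝓓 + λ 𝓝^{1,0} + λ⁻¹ 𝓝^{0,1} + (λ² - 1) q^{1,0} + (λ⁻² - 1) q^{0,1}`. -/
def dLam (Λ : M → ConformalSphere n) (q : EndForm M n) (lam : ℂ) (x : M)
    (X : TangentSpace (𝓡 2) x) (ξ : M → VC n) : VC n :=
  ext (D Λ) x X ξ + lam • part10 Λ (N Λ) x X ξ + lam⁻¹ • part01 Λ (N Λ) x X ξ
    + (lam ^ 2 - 1) • part10 Λ q.op x X ξ + ((lam ^ 2)⁻¹ - 1) • part01 Λ q.op x X ξ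

/-- The value at `λ` of the Laurent polynomial `∑_{k=-d}^{d} p_k λ^k`. -/
def evalL (d : ℕ) (p : ℤ → M → VC n) (lam : ℂ) (x : M) : VC n :=
  ∑ k ∈ Finset.Icc (-(d : ℤ)) d, lam ^ k • p k x

/-- `p(λ) = ∑_{k=-d}^{d} p_k λ^k` is a polynomial conserved quantity of `(Λ, q)` of type `d`. -/
structure IsConservedQuantity (Λ : M → ConformalSphere n) (q : EndForm M n) (d : ℕ)
    (p : ℤ → M → VC n) : Prop where
  smooth : ∀ k ∈ Finset.Icc (-(d : ℤ)) d, ContMDiff (𝓡 2) 𝓘(ℝ, VC n) ∞ (p k)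
  conj : ∀ k ∈ Finset.Icc (-(d : ℤ)) d, ∀ x i, p (-k) x i = starRingEnd ℂ (p k x i)
  top : ∀ x, MemC (Sperp Λ x) (p d x)
  same_parity : ∀ k ∈ Finset.Icc (-(d : ℤ)) d, Even (k - d) → ∀ x, MemC (Sperp Λ x) (p k x)
  other_parity : ∀ k ∈ Finset.Icc (-(d : ℤ)) d, ¬ Even (k - d) → ∀ x, MemC (S Λ x) (p k x)
  ne_zero : evalL d p 1 ≠ 0
  parallel : ∀ lam : ℂ, lam ≠ 0 → ∀ x X, dLam Λ q lam x X (evalL d p lam) = 0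

/-- `(Λ, q)` is a special constrained Willmore surface of type `d`. -/
def IsSpecialConstrainedWillmore [IsManifold (𝓡 2) ∞ M] (Λ : M → ConformalSphere n)
    (q : EndForm M n) (d : ℕ) : Prop :=
  IsConstrainedWillmore Λ q ∧ ∃ p : ℤ → M → VC n, IsConservedQuantity Λ q d p

end Surface

end CW

end

namespace CW

/-! ### Linear algebra of the Lorentzian form -/

/-! Both conditions say that some constant `c ≠ 0` is orthogonal to `Λ`. A type `0` quantity is a
single section `p 0`, real by the conjugation symmetry and lying in `S^⊥`. At `λ = 1` the connection
is `𝓓 + 𝓝 = d`, so on the connected surface `p 0` is constant, and it is orthogonal to `Λ ⊂ S`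
(`IsConservedQuantity.exists_orthogonal`). Such a `c` is space-like: otherwise the null vectors of
`c^⊥` are all multiples of `c`, so `Λ` is constant, which is impossible for an immersion. Hence
`c^⊥` cuts out a proper subsphere (`not_isFull_of_orthogonal`). Conversely, a proper subsphere gives
such a `c` (`exists_orthogonal_of_not_isFull`). Differentiating `(c, σ) = 0` twice puts `c` in
`S^⊥`, so `𝓓` and `𝓝` kill it; `q` kills it because `c ⊥ Λ^{(1)}`. Hence `c` is parallel for every
`λ` (`isConservedQuantity_const`). -/

theorem lor_apply {n : ℕ} (v w : V n) :
    lor n v w = ∑ i : Fin (n + 1), v i.castSucc * w i.castSucc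
      - v (Fin.last (n + 1)) * w (Fin.last (n + 1)) := by
  have hne : ∀ i : Fin (n + 1), i.castSucc ≠ Fin.last (n + 1) := fun i => Fin.castSucc_ne_last i
  simp [lor, Matrix.toBilin'_apply', dotProduct, Matrix.mulVec_diagonal, Fin.sum_univ_castSucc, hne,
    sub_eq_add_neg]

theorem lor_comm {n : ℕ} (v w : V n) : lor n v w = lor n w v := by
  simp only [lor_apply, mul_comm]

theorem lor_nondegenerate (n : ℕ) : (lor n).Nondegenerate := by
  rw [lor, LinearMap.BilinForm.nondegenerate_toBilin'_iff_det_ne_zero, Matrix.det_diagonal,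
    Finset.prod_ne_zero_iff]
  intro i _
  split_ifs <;> norm_num

/-- A vector `c` with `(c, c) ≤ 0` that is orthogonal to a null vector with last coordinate `1` is
a multiple of it. -/
theorem eq_smul_of_lor_nonpos {n : ℕ} {c v : V n} (hc : lor n c c ≤ 0) (hv : lor n v v = 0)
    (hv1 : v (Fin.last (n + 1)) = 1) (hcv : lor n c v = 0) : c = c (Fin.last (n + 1)) • v := by
  set t := c (Fin.last (n + 1)) with ht
  -- `t` is chosen to cancel the last coordinate of `c - t • v`. The form is positive definite on
  -- vectors with last coordinate `0`, so a nonpositive square forces the difference to vanish.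
  have hz : lor n (c - t • v) (c - t • v) ≤ 0 := by
    simp only [map_sub, map_smul, LinearMap.sub_apply, LinearMap.smul_apply, smul_eq_mul, hv, hcv,
      lor_comm v c]
    linarith
  have hl : (c - t • v) (Fin.last (n + 1)) = 0 := by simp [hv1, ht]
  rw [lor_apply, hl, mul_zero, sub_zero] at hz
  have h0 := (Finset.sum_eq_zero_iff_of_nonneg fun i _ => mul_self_nonneg _).1
    (le_antisymm hz (Finset.sum_nonneg fun i _ => mul_self_nonneg _))
  rw [← sub_eq_zero]
  funext i
  induction i using Fin.lastCases with
  | last => exact hl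
  | cast i => exact mul_self_eq_zero.1 (h0 i (Finset.mem_univ i))

/-- The orthogonal complement of a space-like vector contains a time-like one. -/
theorem exists_timelike_of_spacelike {n : ℕ} {c : V n} (hc : 0 < lor n c c) :
    ∃ w, lor n c w = 0 ∧ lor n w w < 0 := by
  set u : V n := Pi.single (Fin.last (n + 1)) 1 with hu
  have huu : lor n u u = -1 := by simp [lor_apply, hu, Fin.castSucc_ne_last]
  -- The projection of the unit time-like `u` to `c^⊥` has square `-1 - (c, u)² / (c, c) < 0`.
  refine ⟨u - (lor n c u / lor n c c) • c, ?_, ?_⟩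
  · simp only [map_sub, map_smul, smul_eq_mul]
    field_simp
    ring
  · simp only [map_sub, map_smul, LinearMap.sub_apply, LinearMap.smul_apply, smul_eq_mul, huu,
      lor_comm u c]
    have h1 : 0 ≤ lor n c u ^ 2 / lor n c c := by positivity
    have h2 : -1 - lor n c u / lor n c c * lor n c u - lor n c u / lor n c c *
        (lor n c u - lor n c u / lor n c c * lor n c c)
        = -1 - lor n c u ^ 2 / lor n c c := by
      field_simp
      ring
    linarith

/-- A proper subspace is contained in a hyperplane `c^⊥`. -/
theorem exists_orthogonal_ne_zero {n : ℕ} {W : Submodule ℝ (V n)}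
    (hW : Module.finrank ℝ W < n + 2) : ∃ c ≠ 0, ∀ w ∈ W, lor n c w = 0 := by
  have h := LinearMap.BilinForm.finrank_orthogonal (lor_nondegenerate n) W
  rw [Module.finrank_fin_fun] at h
  have hpos : (lor n).orthogonal W ≠ ⊥ := by
    intro hb
    rw [hb, finrank_bot] at h
    omega
  obtain ⟨c, hc, hc0⟩ := Submodule.exists_mem_ne_zero_of_ne_bot hpos
  exact ⟨c, hc0, fun w hw => (lor_comm c w).trans (hc w hw)⟩

/-! ### The lift -/

section Lift

variable {M : Type*} {n : ℕ} (Λ : M → ConformalSphere n) (x : M)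

/-- A null vector with last coordinate `0` has vanishing sum of squares, hence is zero. This makes
the normalisation in `lift` legitimate. -/
theorem rep_last_ne_zero : (Λ x).1.rep (Fin.last (n + 1)) ≠ 0 := by
  intro h0
  have hnull : lor n (Λ x).1.rep (Λ x).1.rep = 0 :=
    (Λ x).2 _ (by rw [Projectivization.submodule_eq]; exact Submodule.mem_span_singleton_self _)
  rw [lor_apply, h0, mul_zero, sub_zero] at hnull
  have h := (Finset.sum_eq_zero_iff_of_nonneg fun i _ => mul_self_nonneg _).1 hnull
  refine (Λ x).1.rep_nonzero (funext fun i => ?_)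
  induction i using Fin.lastCases with
  | last => exact h0
  | cast i => exact mul_self_eq_zero.1 (h i (Finset.mem_univ i))

theorem lift_last : lift Λ x (Fin.last (n + 1)) = 1 := by
  simp [lift, rep_last_ne_zero Λ x]

theorem line_eq_span_lift : (Λ x).line = Submodule.span ℝ {lift Λ x} := by
  rw [ConformalSphere.line, Projectivization.submodule_eq, lift,
    Submodule.span_singleton_smul_eq (inv_ne_zero (rep_last_ne_zero Λ x)).isUnit]

theorem lift_mem_line : lift Λ x ∈ (Λ x).line := by
  rw [line_eq_span_lift]
  exact Submodule.mem_span_singleton_self _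

theorem lor_lift_lift : lor n (lift Λ x) (lift Λ x) = 0 := (Λ x).2 _ (lift_mem_line Λ x)

/-- A surface that is not full lies in a hyperplane `c^⊥` with `c ≠ 0`. -/
theorem exists_orthogonal_of_not_isFull {Λ : M → ConformalSphere n} (h : ¬ IsFull Λ) :
    ∃ c : V n, c ≠ 0 ∧ ∀ y, lor n c (lift Λ y) = 0 := by
  simp only [IsFull, not_forall, not_not] at h
  obtain ⟨k, hk, s, ⟨W, hW, -, rfl⟩, hs⟩ := h
  obtain ⟨c, hc0, hc⟩ := exists_orthogonal_ne_zero (W := W) (by omega)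
  exact ⟨c, hc0, fun y => hc _ (hs ⟨y, rfl⟩ (lift_mem_line Λ y))⟩

end Lift

theorem evalL_type_zero {M : Type*} {n : ℕ} (p : ℤ → M → VC n) (lam : ℂ) :
    evalL 0 p lam = p 0 := by
  funext y
  simp [evalL]

section Surface

variable {M : Type*} [TopologicalSpace M] [ChartedSpace E2 M] {n : ℕ}

/-! ### Maps with vanishing derivative -/

/-- A differentiable map on a connected surface with zero derivative is constant. -/
theorem eq_of_mfderiv_eq_zero [IsManifold (𝓡 2) ∞ M] [PreconnectedSpace M] {F : Type*}
    [NormedAddCommGroup F] [NormedSpace ℝ F] {u : M → F}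
    (hu : ContMDiff (𝓡 2) 𝓘(ℝ, F) ∞ u) (h0 : ∀ x, mfderiv (𝓡 2) 𝓘(ℝ, F) u x = 0) (x y : M) :
    u x = u y := by
  have : IsManifold (𝓡 2) 1 M := .of_le (n := ∞) (by simp)
  have hd : MDifferentiable (𝓡 2) 𝓘(ℝ, F) u := hu.mdifferentiable (by simp)
  refine IsLocallyConstant.apply_eq_of_preconnectedSpace (f := u) ?_ x y
  rw [IsLocallyConstant.iff_eventually_eq]
  intro x
  set φ := chartAt E2 x
  have hsymm : ∀ z ∈ φ.target, MDifferentiableAt (𝓡 2) (𝓡 2) φ.symm z := fun z hz =>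
    mdifferentiableAt_atlas_symm (chart_mem_atlas E2 x) hz
  have hdiff : DifferentiableOn ℝ (u ∘ φ.symm) φ.target := fun z hz =>
    (((hd _).comp z (hsymm z hz)).differentiableAt).differentiableWithinAt
  have hzero : φ.target.EqOn (fderiv ℝ (u ∘ φ.symm)) 0 := fun z hz => by
    have hc := mfderiv_comp (I := 𝓡 2) z (hd (φ.symm z)) (hsymm z hz)
    rw [h0] at hc
    rw [← mfderiv_eq_fderiv]
    exact hc.trans (ContinuousLinearMap.zero_comp _)
  -- Zero derivative on an open set makes the map locally constant there, so even the preimage of a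
  -- point is open.
  have hopen := φ.open_target.isOpen_inter_preimage_of_fderiv_eq_zero hdiff hzero {u x}
  have hmem : φ x ∈ φ.target ∩ (u ∘ φ.symm) ⁻¹' {u x} :=
    ⟨mem_chart_target E2 x, by simp [φ]⟩
  filter_upwards [φ.continuousAt (mem_chart_source E2 x) (hopen.mem_nhds hmem),
    φ.open_source.mem_nhds (mem_chart_source E2 x)] with y hy hys
  have := hy.2
  simpa [φ.left_inv hys] using this

/-- The chain rule for `(c, f) = 0`. Where `f` is not differentiable, `mfderiv` is `0` by
convention, so no regularity is needed; this spares any differentiability check on the coefficients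
in `laplacian`. -/
theorem lor_dd_eq_zero {c : V n} {f : M → V n} (hf : ∀ y, lor n c (f y) = 0) (x : M)
    (X : TangentSpace (𝓡 2) x) : lor n c (dd f x X) = 0 := by
  unfold dd
  by_cases hd : MDifferentiableAt (𝓡 2) 𝓘(ℝ, V n) f x
  · set L : V n →L[ℝ] ℝ := LinearMap.toContinuousLinearMap (lor n c)
    have hL : MDifferentiableAt 𝓘(ℝ, V n) 𝓘(ℝ, ℝ) L (f x) :=
      L.differentiableAt.mdifferentiableAt
    have hcomp := mfderiv_comp x hL hd
    have h0 : (L ∘ f) = fun _ => (0 : ℝ) := funext hf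
    rw [h0, mfderiv_const, mfderiv_eq_fderiv, L.fderiv] at hcomp
    exact (DFunLike.congr_fun hcomp X).symm
  · rw [mfderiv_zero_of_not_mdifferentiableAt hd]
    exact map_zero _

theorem lor_pd_eq_zero {c : V n} {f : E2 → V n} (hf : ∀ y, lor n c (f y) = 0) (i : Fin 2)
    (y : E2) : lor n c (pd i f y) = 0 := by
  have h := lor_dd_eq_zero hf y (e i)
  unfold dd at h
  rwa [mfderiv_eq_fderiv] at h

theorem lor_laplacian_eq_zero {c : V n} {σ : M → V n} (hσ : ∀ y, lor n c (σ y) = 0) (x : M) :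
    lor n c (laplacian σ x) = 0 := by
  simp only [laplacian, map_smul, map_sum, smul_eq_mul]
  refine mul_eq_zero_of_right _ (Finset.sum_eq_zero fun i _ => lor_pd_eq_zero (fun y => ?_) i _)
  simp only [map_smul, map_sum, smul_eq_mul]
  refine mul_eq_zero_of_right _ (Finset.sum_eq_zero fun j _ => mul_eq_zero_of_right _ ?_)
  exact lor_pd_eq_zero (fun z => hσ _) j y

variable {Λ : M → ConformalSphere n} (x : M)

/-- If `Λ` lies in the hyperplane `c^⊥`, then so does `Λ^{(1)}`. -/
theorem Lam1_le_ker {c : V n} (hc : ∀ y, lor n c (lift Λ y) = 0) :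
    Lam1 Λ x ≤ LinearMap.ker (lor n c) := by
  rw [Lam1, line_eq_span_lift, sup_le_iff, Submodule.span_le, Submodule.span_le]
  refine ⟨by simpa using hc x, ?_⟩
  rintro _ ⟨X, rfl⟩
  exact lor_dd_eq_zero hc x X

/-- If `Λ` lies in the hyperplane `c^⊥`, then `c` is a section of `S^⊥`. -/
theorem mem_Sperp_of_orthogonal_lift {c : V n} (hc : ∀ y, lor n c (lift Λ y) = 0) :
    c ∈ Sperp Λ x := by
  have hS : S Λ x ≤ LinearMap.ker (lor n c) := by
    rw [S, sup_le_iff, Submodule.span_singleton_le_iff_mem]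
    exact ⟨Lam1_le_ker x hc, lor_laplacian_eq_zero hc x⟩
  exact fun w hw => (lor_comm w c).trans (hS hw)

/-! ### Sections of `S^⊥` -/

/-- This holds in the default case `piS = 0` too, so nondegeneracy of `S` need not be established.
-/
theorem piS_of_mem_Sperp {v : V n} (hv : v ∈ Sperp Λ x) : piS Λ x v = 0 := by
  unfold piS
  split_ifs with h
  · exact (Submodule.projection_apply_eq_zero_iff h).2 hv
  · rfl

theorem piP_of_mem_Sperp {v : V n} (hv : v ∈ Sperp Λ x) : piP Λ x v = v := by
  simp [piP, piS_of_mem_Sperp x hv]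

theorem dd_const (c : V n) (X : TangentSpace (𝓡 2) x) : dd (fun _ : M => c) x X = 0 := by
  rw [dd, mfderiv_const]
  rfl

theorem D_of_mem_Sperp {u : M → V n} (hu : ∀ y, u y ∈ Sperp Λ y) (X : TangentSpace (𝓡 2) x) :
    D Λ x X u = piP Λ x (dd u x X) := by
  have h1 : (fun y => piS Λ y (u y)) = fun _ => 0 := funext fun y => piS_of_mem_Sperp y (hu y)
  have h2 : (fun y => piP Λ y (u y)) = u := funext fun y => piP_of_mem_Sperp y (hu y)
  rw [D, h1, h2, dd_const, map_zero, zero_add]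

theorem N_of_mem_Sperp {u : M → V n} (hu : ∀ y, u y ∈ Sperp Λ y) (X : TangentSpace (𝓡 2) x) :
    N Λ x X u = piS Λ x (dd u x X) := by
  have h1 : (fun y => piS Λ y (u y)) = fun _ => 0 := funext fun y => piS_of_mem_Sperp y (hu y)
  have h2 : (fun y => piP Λ y (u y)) = u := funext fun y => piP_of_mem_Sperp y (hu y)
  rw [N, h1, h2, dd_const, map_zero, zero_add]

/-- `q ∈ Ω¹(Λ ∧ Λ^{(1)})` annihilates the vectors orthogonal to `Λ`. -/
theorem q_apply_eq_zero [IsManifold (𝓡 2) ∞ M] {q : EndForm M n}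
    (h : IsConstrainedWillmore Λ q) {c : V n} (hc : ∀ y, lor n c (lift Λ y) = 0)
    (X : TangentSpace (𝓡 2) x) : q x X c = 0 := by
  have hle : Submodule.span ℝ {T | ∃ u ∈ (Λ x).line, ∃ v ∈ Lam1 Λ x, T = wedge u v} ≤
      LinearMap.ker (LinearMap.applyₗ (R := ℝ) (M₂ := V n) c) := by
    rw [Submodule.span_le]
    rintro _ ⟨u, hu, v, hv, rfl⟩
    have hu0 : lor n u c = 0 :=
      (lor_comm u c).trans (Lam1_le_ker x hc (Submodule.mem_sup_left hu))
    have hv0 : lor n v c = 0 := (lor_comm v c).trans (Lam1_le_ker x hc hv)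
    simp [wedge, hu0, hv0]
  exact hle (h.q_mem x X)

/-! ### Complexification -/

theorem mkC_zero : mkC (0 : V n) 0 = 0 := rfl

theorem re_mkC (u v : V n) : re (mkC u v) = u := rfl

theorem im_mkC (u v : V n) : im (mkC u v) = v := rfl

theorem re_mkC_add (u v u' v' : V n) : re (mkC u v + mkC u' v') = u + u' := rfl

/-- At `λ = 1` the connection `d^λ_q` is `𝓓 + 𝓝`. -/
theorem dLam_one (q : EndForm M n) (X : TangentSpace (𝓡 2) x) (ξ : M → VC n) :
    dLam Λ q 1 x X ξ = ext (D Λ) x X ξ + ext (N Λ) x X ξ := by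
  simp only [dLam, part10, part01, one_smul, inv_one, one_pow, sub_self, zero_smul, add_zero]
  -- The `(1,0)`- and `(0,1)`-parts of `𝓝` add up to `𝓝`.
  module

/-- A real constant section orthogonal to `Λ` is parallel for all the connections `d^λ_q`. -/
theorem dLam_const_eq_zero [IsManifold (𝓡 2) ∞ M] {q : EndForm M n}
    (h : IsConstrainedWillmore Λ q) {c : V n} (hc : ∀ y, lor n c (lift Λ y) = 0) (lam : ℂ)
    (X : TangentSpace (𝓡 2) x) : dLam Λ q lam x X (fun _ => mkC c 0) = 0 := by
  have hext : ∀ (A : OpForm M n) (Z : TangentSpace (𝓡 2) x), A x Z (fun _ => c) = 0 →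
      A x Z (fun _ => 0) = 0 → ext A x Z (fun _ => mkC c 0) = 0 := fun A Z h1 h2 => by
    simp only [ext, re_mkC, im_mkC, h1, h2, mkC_zero]
  have hD : ∀ Z, ext (D Λ) x Z (fun _ => mkC c 0) = 0 := fun Z =>
    hext _ Z
      (by rw [D_of_mem_Sperp x (fun y => mem_Sperp_of_orthogonal_lift y hc), dd_const, map_zero])
      -- The imaginary part is the zero section, itself a section of `S^⊥`.
      (by rw [D_of_mem_Sperp x (fun y => zero_mem _), dd_const, map_zero])
  have hN : ∀ Z, ext (N Λ) x Z (fun _ => mkC c 0) = 0 := fun Z =>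
    hext _ Z
      (by rw [N_of_mem_Sperp x (fun y => mem_Sperp_of_orthogonal_lift y hc), dd_const, map_zero])
      (by rw [N_of_mem_Sperp x (fun y => zero_mem _), dd_const, map_zero])
  have hq : ∀ Z, ext q.op x Z (fun _ => mkC c 0) = 0 := fun Z =>
    hext _ Z (q_apply_eq_zero x h hc Z) (map_zero _)
  simp only [dLam, part10, part01, hD, hN, hq, smul_zero, sub_zero, add_zero]

/-! ### Fullness -/

/-- An immersed surface that lies in a hyperplane `c^⊥` with `c ≠ 0` is not full. -/
theorem not_isFull_of_orthogonal [IsManifold (𝓡 2) ∞ M] [Nonempty M] (hΛ : IsSurface Λ)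
    {c : V n} (hc0 : c ≠ 0) (hc : ∀ y, lor n c (lift Λ y) = 0) (hn : 1 ≤ n) : ¬ IsFull Λ := by
  have hpos : 0 < lor n c c := by
    by_contra! hneg
    have hsmul : ∀ y, c = c (Fin.last (n + 1)) • lift Λ y := fun y =>
      eq_smul_of_lor_nonpos hneg (lor_lift_lift Λ y) (lift_last Λ y) (hc y)
    obtain ⟨x⟩ := ‹Nonempty M›
    have ht : c (Fin.last (n + 1)) ≠ 0 := fun h0 => hc0 (by rw [hsmul x, h0, zero_smul])
    have hconst : lift Λ = fun _ => (c (Fin.last (n + 1)))⁻¹ • c := funext fun y => by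
      rw [eq_inv_smul_iff₀ ht]
      exact (hsmul y).symm
    have hinj := hΛ.immersion x
    rw [hconst, mfderiv_const] at hinj
    -- A constant lift has zero derivative, which cannot be injective on a plane.
    have he : (e 0 : E2) = 0 := hinj (a₁ := (e 0 : E2)) (a₂ := (0 : E2)) rfl
    simpa [e] using congrArg (fun v : E2 => v 0) he
  obtain ⟨w, hw, hww⟩ := exists_timelike_of_spacelike hpos
  intro hfull
  -- The hyperplane has dimension `n + 1 = (n - 1) + 2`, so it gives a subsphere of dimension `n -
  -- 1`.
  refine hfull (n - 1) (by omega) _ ⟨(lor n).orthogonal (ℝ ∙ c), ?_, ⟨w, ?_, hww⟩, rfl⟩ ?_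
  · rw [LinearMap.BilinForm.finrank_orthogonal (lor_nondegenerate n), Module.finrank_fin_fun,
      finrank_span_singleton hc0]
    omega
  · intro v hv
    obtain ⟨t, rfl⟩ := Submodule.mem_span_singleton.1 hv
    simp [hw]
  · rintro _ ⟨y, rfl⟩
    change (Λ y).line ≤ _
    rw [line_eq_span_lift, Submodule.span_singleton_le_iff_mem]
    intro v hv
    obtain ⟨t, rfl⟩ := Submodule.mem_span_singleton.1 hv
    simp [hc y]

/-- A conserved quantity of type `0` is a non-zero real constant orthogonal to `Λ`. -/
theorem IsConservedQuantity.exists_orthogonal [IsManifold (𝓡 2) ∞ M] [PreconnectedSpace M]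
    {q : EndForm M n} {p : ℤ → M → VC n} (hp : IsConservedQuantity Λ q 0 p) :
    ∃ c : V n, c ≠ 0 ∧ ∀ y, lor n c (lift Λ y) = 0 := by
  have h0 : (0 : ℤ) ∈ Finset.Icc (-((0 : ℕ) : ℤ)) (0 : ℕ) := by simp
  set u : M → V n := fun y => re (p 0 y) with hu
  have hmem : ∀ y, u y ∈ Sperp Λ y := fun y => (hp.top y).1
  have hsmooth : ContMDiff (𝓡 2) 𝓘(ℝ, V n) ∞ u := by
    have hre : ContDiff ℝ ∞ (re : VC n → V n) :=
      contDiff_pi.2 fun i => Complex.reCLM.contDiff.comp (contDiff_apply ℝ ℂ i)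
    exact hre.contMDiff.comp (hp.smooth 0 h0)
  have hdd : ∀ x X, dd u x X = 0 := fun x X => by
    have h1 := hp.parallel 1 one_ne_zero x X
    rw [evalL_type_zero, dLam_one] at h1
    have h2 := congrArg re h1
    rw [ext, ext, re_mkC_add, D_of_mem_Sperp x hmem, N_of_mem_Sperp x hmem] at h2
    -- The `S^⊥`-part from `𝓓` and the `S`-part from `𝓝` reassemble `du`.
    simp only [piP, LinearMap.sub_apply, LinearMap.id_apply, sub_add_cancel] at h2
    exact h2
  have hconst := eq_of_mfderiv_eq_zero hsmooth fun x => ContinuousLinearMap.ext (hdd x)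
  obtain ⟨x, hx⟩ : ∃ x, u x ≠ 0 := by
    by_contra! hall
    refine hp.ne_zero ?_
    rw [evalL_type_zero]
    funext y i
    -- The symmetry at `k = 0` makes `p 0` real, so it would vanish along with its real part.
    have hi : p 0 y i = starRingEnd ℂ (p 0 y i) := by simpa using hp.conj 0 h0 y i
    exact Complex.ext (congrFun (hall y) i) (Complex.conj_eq_iff_im.1 hi.symm)
  refine ⟨u x, hx, fun y => ?_⟩
  rw [hconst x y, lor_comm]
  exact hmem y _ (Submodule.mem_sup_left (Submodule.mem_sup_left (lift_mem_line Λ y)))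

/-- A non-zero constant orthogonal to `Λ` is a conserved quantity of type `0`. -/
theorem isConservedQuantity_const [IsManifold (𝓡 2) ∞ M] [Nonempty M] {q : EndForm M n}
    (h : IsConstrainedWillmore Λ q) {c : V n} (hc0 : c ≠ 0)
    (hc : ∀ y, lor n c (lift Λ y) = 0) :
    IsConservedQuantity Λ q 0 (fun _ _ => mkC c 0) := by
  have hS : ∀ y, MemC (Sperp Λ y) (mkC c 0) := fun y =>
    ⟨mem_Sperp_of_orthogonal_lift y hc, zero_mem _⟩
  refine ⟨fun _ _ => contMDiff_const, fun _ _ _ i => ?_, hS, fun _ _ _ => hS, fun k hk hodd => ?_,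
    fun hz => ?_, fun lam _ x X => ?_⟩
  · exact Complex.ext rfl (by simp [mkC])
  · simp only [Nat.cast_zero, neg_zero, Finset.Icc_self, Finset.mem_singleton] at hk
    simp [hk] at hodd
  · obtain ⟨x⟩ := ‹Nonempty M›
    rw [evalL_type_zero] at hz
    exact hc0 (congrArg re (congrFun hz x))
  · rw [evalL_type_zero]
    exact dLam_const_eq_zero x h hc lam X

end Surface

end CW

theorem mainTheorem7 {M : Type*} [TopologicalSpace M] [T2Space M] [SecondCountableTopology M]
    [ConnectedSpace M] [ChartedSpace CW.E2 M] [IsManifold (𝓡 2) ∞ M] [CW.OrientedAtlas M]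
    (n : ℕ) (hn : 3 ≤ n) (Λ : M → CW.ConformalSphere n) (q : CW.EndForm M n)
    (h : CW.IsConstrainedWillmore Λ q) :
    CW.IsSpecialConstrainedWillmore Λ q 0 ↔ ¬ CW.IsFull Λ := by
  refine ⟨fun ⟨_, p, hp⟩ => ?_, fun hfull => ⟨h, ?_⟩⟩
  · obtain ⟨c, hc0, hc⟩ := hp.exists_orthogonal
    exact CW.not_isFull_of_orthogonal h.surface hc0 hc (by omega)
  · obtain ⟨c, hc0, hc⟩ := CW.exists_orthogonal_of_not_isFull hfull
    exact ⟨_, CW.isConservedQuantity_const h hc0 hc⟩
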